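/- For a real matrix $X\in\mathbb{R}^{m\times n}$ let $\sigma_1(X)\ge\dots\ge\sigma_{\min(m,n)}(X)\ge 0$ be its singular values, let $\|X\|_{\mathrm{tr}}=\sum_{i=1}^{\min(m,n)}\sigma_i(X)$ be its trace norm, and let $\|X\|_{S_{1/2}}=\bigl(\sum_{i=1}^{\min(m,n)}\sigma_i(X)^{1/2}\bigr)^2$ be its Schatten-$1/2$ quasi-norm. For an integer $d\ge\operatorname{rank}(X)$ the bi-trace norm of $X$ is $$\|X\|_{\mathrm{Bi\text{-}tr}}:=\min_{U\in\mathbb{R}^{m\times d},\,V\in\mathbb{R}^{n\times d}:\,X=UV^{T}}\|U\|_{\mathrm{tr}}\|V\|_{\mathrm{tr}}.$$ Theorem. Let $m,n$ be given. (1) The bi-trace norm is a quasi-norm: there is a constant $\alpha\ge 1$, depending only on $m$ and $n$, such that for every $d$ and all $X,Y\in\mathbb{R}^{m\times n}$ for which $X$, $Y$ and $X+Y$ have rank at most $d$, and every $a\in\mathbb{R}$: $\|X\|_{\mathrm{Bi\text{-}tr}}\ge 0$, with equality if and only if $X=0$; $\|aX\|_{\mathrm{Bi\text{-}tr}}=|a|\,\|X\|_{\mathrm{Bi\text{-}tr}}$;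 and $\|X+Y\|_{\mathrm{Bi\text{-}tr}}\le\alpha\bigl(\|X\|_{\mathrm{Bi\text{-}tr}}+\|Y\|_{\mathrm{Bi\text{-}tr}}\bigr)$. In particular, for $d\ge\min(m,n)$ it is a quasi-norm on the whole space $\mathbb{R}^{m\times n}$. (2) For every $d$ and every $X\in\mathbb{R}^{m\times n}$ with $\operatorname{rank}(X)\le d$, the minimum defining $\|X\|_{\mathrm{Bi\text{-}tr}}$ is attained, $\|X\|_{\mathrm{Bi\text{-}tr}}=\|X\|_{S_{1/2}}$, and $$\|X\|_{\mathrm{Bi\text{-}tr}}=\min_{X=UV^{T}}\frac{\|U\|_{\mathrm{tr}}^2+\|V\|_{\mathrm{tr}}^2}{2}=\min_{X=UV^{T}}\left(\frac{\|U\|_{\mathrm{tr}}+\|V\|_{\mathrm{tr}}}{2}\right)^2,$$ where both minima are over $U\in\mathbb{R}^{m\times d}$, $V\in\mathbb{R}^{n\times d}$ and are attained. -/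

import Mathlib

noncomputable section

/-- `matrixSingularValue X i` is the `i`-th (counted from `0`, in decreasing order) singular value
of the real matrix `X`, acting between Euclidean spaces. -/
def matrixSingularValue {m n : ℕ} (X : Matrix (Fin m) (Fin n) ℝ) (i : ℕ) : ℝ :=
  (Matrix.toEuclideanLin X).singularValues i

/-- The trace (nuclear) norm: the sum of the singular values. -/
def traceNorm {m n : ℕ} (X : Matrix (Fin m) (Fin n) ℝ) : ℝ :=
  ∑ i ∈ Finset.range (min m n), matrixSingularValue X i

/-- The Schatten-`p` (quasi-)norm `(∑ σᵢ(X) ^ p) ^ (1 / p)`, for `0 < p`. -/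
def schattenNorm (p : ℝ) {m n : ℕ} (X : Matrix (Fin m) (Fin n) ℝ) : ℝ :=
  (∑ i ∈ Finset.range (min m n), matrixSingularValue X i ^ p) ^ (1 / p)

/-- The bi-trace norm of `X` with inner dimension `d`: the infimum of `‖U‖_tr * ‖V‖_tr` over all
factorizations `X = U Vᵀ` with `U` of size `m × d` and `V` of size `n × d`. It is meant for
`X.rank ≤ d`; that the infimum is then a minimum is part of the theorem. -/
def biTraceNorm (d : ℕ) {m n : ℕ} (X : Matrix (Fin m) (Fin n) ℝ) : ℝ :=
  sInf {t : ℝ | ∃ (U : Matrix (Fin m) (Fin d) ℝ) (V : Matrix (Fin n) (Fin d) ℝ),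
    X = U * V.transpose ∧ t = traceNorm U * traceNorm V}

/-- `N` satisfies the axioms of a quasi-norm, with constant `α` in the quasi-triangle inequality,
at the elements of the set `S`. For `S = Set.univ` this says that `N` is a quasi-norm on `E`. -/
structure IsQuasiNormOn {E : Type*} [AddCommGroup E] [Module ℝ E] (α : ℝ) (S : Set E)
    (N : E → ℝ) : Prop where
  nonneg : ∀ x ∈ S, 0 ≤ N x
  eq_zero_iff : ∀ x ∈ S, N x = 0 ↔ x = 0
  smul : ∀ (a : ℝ), ∀ x ∈ S, a • x ∈ S ∧ N (a • x) = |a| * N x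
  add_le : ∀ x ∈ S, ∀ y ∈ S, x + y ∈ S → N (x + y) ≤ α * (N x + N y)

end

/-! Everything rests on the Hölder inequality `sq_sum_sqrt_singularValues_comp_adjoint_le`, by which
every factorization of X costs at least its Schatten-1/2 quasi-norm. Splitting each singular value
evenly as √σ · √σ attains equality with both factors of equal trace norm. By AM-GM the other two
objectives dominate the product and agree with it when the norms are equal, so all three minima
coincide. The quasi-triangle inequality follows by comparison with the trace norm, which is
subadditive by its variational formula. -/

noncomputable section

/-! ### Singular value decomposition and the variational formula for the trace norm -/

section SingularValueDecomposition

open Module InnerProductSpace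

variable {E F G ι κ : Type*} [NormedAddCommGroup E] [InnerProductSpace ℝ E]
  [NormedAddCommGroup F] [InnerProductSpace ℝ F] [NormedAddCommGroup G] [InnerProductSpace ℝ G]
  [Fintype ι] [Fintype κ]

/-- The linear map `x ↦ ∑ i, s i * ⟪v i, x⟫ • u i`. -/
def diagMap (s : ι → ℝ) (u : ι → F) (v : ι → E) : E →ₗ[ℝ] F :=
  ∑ i, s i • (innerₛₗ ℝ (v i)).smulRight (u i)

theorem diagMap_apply (s : ι → ℝ) (u : ι → F) (v : ι → E) (x : E) :
    diagMap s u v x = ∑ i, (s i * inner ℝ (v i) x) • u i := by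
  simp [diagMap, LinearMap.sum_apply, smul_smul]

theorem inner_diagMap_apply (s : ι → ℝ) (u : ι → F) (v : ι → E) (x : E) (y : F) :
    inner ℝ y (diagMap s u v x) = ∑ i, s i * (inner ℝ (v i) x * inner ℝ (u i) y) := by
  rw [diagMap_apply, inner_sum]
  refine Finset.sum_congr rfl fun i _ => ?_
  rw [inner_smul_right, real_inner_comm (u i), mul_assoc]

theorem diagMap_apply_right (s : ι → ℝ) (u : ι → F) {v : ι → E} (hv : Orthonormal ℝ v) (i : ι) :
    diagMap s u v (v i) = s i • u i := by
  classical
  simp [diagMap_apply, orthonormal_iff_ite.1 hv]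

theorem adjoint_diagMap [FiniteDimensional ℝ E] [FiniteDimensional ℝ F]
    (s : ι → ℝ) (u : ι → F) (v : ι → E) :
    LinearMap.adjoint (diagMap s u v) = diagMap s v u := by
  symm
  rw [LinearMap.eq_adjoint_iff]
  intro x y
  rw [real_inner_comm, inner_diagMap_apply, inner_diagMap_apply]
  exact Finset.sum_congr rfl fun i _ => by ring

theorem Orthonormal.sum_inner_sq_le {v : ι → E} (hv : Orthonormal ℝ v) (x : E) :
    ∑ i, inner ℝ (v i) x ^ 2 ≤ ‖x‖ ^ 2 := by
  simpa using hv.sum_inner_products_le (s := Finset.univ) (x := x)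

/-- Von Neumann's bound: pairing a map with orthonormal families is at most the sum of its
singular values. -/
theorem abs_sum_inner_diagMap_le {s : ι → ℝ} (hs : ∀ i, 0 ≤ s i) {u : ι → F} {v : ι → E}
    (hu : Orthonormal ℝ u) (hv : Orthonormal ℝ v) {a : κ → F} {b : κ → E}
    (ha : Orthonormal ℝ a) (hb : Orthonormal ℝ b) :
    |∑ k, inner ℝ (a k) (diagMap s u v (b k))| ≤ ∑ i, s i := by
  simp_rw [inner_diagMap_apply]
  rw [Finset.sum_comm]
  refine (Finset.abs_sum_le_sum_abs _ _).trans (Finset.sum_le_sum fun i _ => ?_)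
  rw [← Finset.mul_sum, abs_mul, abs_of_nonneg (hs i)]
  refine mul_le_of_le_one_right (hs i) ?_
  -- Bessel's inequality for the unit vectors `v i` and `u i`; Cauchy–Schwarz then bounds the
  -- coefficient of `s i` by 1.
  have h1 : ∑ k, inner ℝ (v i) (b k) ^ 2 ≤ 1 := by
    simpa [real_inner_comm, hv.1 i] using hb.sum_inner_sq_le (v i)
  have h2 : ∑ k, inner ℝ (u i) (a k) ^ 2 ≤ 1 := by
    simpa [real_inner_comm, hu.1 i] using ha.sum_inner_sq_le (u i)
  rw [← sq_le_one_iff_abs_le_one]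
  calc _ ≤ _ := Finset.sum_mul_sq_le_sq_mul_sq _ _ _
    _ ≤ 1 := mul_le_one₀ h1 (Finset.sum_nonneg fun _ _ => sq_nonneg _) h2

theorem sum_inner_diagMap_self (s : ι → ℝ) {u : ι → F} {v : ι → E}
    (hu : Orthonormal ℝ u) (hv : Orthonormal ℝ v) :
    ∑ i, inner ℝ (u i) (diagMap s u v (v i)) = ∑ i, s i := by
  refine Finset.sum_congr rfl fun i _ => ?_
  rw [diagMap_apply_right s u hv, inner_smul_right, real_inner_self_eq_norm_sq, hu.1 i]
  ring

theorem Orthonormal.sum_inner_smul_eq_of_mem_span {p : ι → E} (hp : Orthonormal ℝ p) {x : E}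
    (hx : x ∈ Submodule.span ℝ (Set.range p)) : ∑ k, inner ℝ (p k) x • p k = x := by
  obtain ⟨c, rfl⟩ := (Submodule.mem_span_range_iff_exists_fun ℝ).1 hx
  exact Finset.sum_congr rfl fun k _ => by rw [hp.inner_right_fintype]

theorem Orthonormal.sum_inner_mul_inner_of_mem_span {p : ι → E} (hp : Orthonormal ℝ p) {x : E}
    (hx : x ∈ Submodule.span ℝ (Set.range p)) (y : E) :
    ∑ k, inner ℝ (p k) x * inner ℝ (p k) y = inner ℝ x y := by
  conv_rhs => rw [← hp.sum_inner_smul_eq_of_mem_span hx]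
  rw [sum_inner]
  exact Finset.sum_congr rfl fun k _ => by rw [inner_smul_left]; rfl

variable [FiniteDimensional ℝ E] [FiniteDimensional ℝ F] [FiniteDimensional ℝ G]

/-- The (reduced) singular value decomposition. -/
theorem exists_eq_diagMap_singularValues (T : E →ₗ[ℝ] F) :
    ∃ (u : Fin (finrank ℝ T.range) → F) (v : Fin (finrank ℝ T.range) → E),
      Orthonormal ℝ u ∧ Orthonormal ℝ v ∧ T = diagMap (fun i : Fin (finrank ℝ T.range) => T.singularValues i) u v := by
  have hr : finrank ℝ T.range ≤ finrank ℝ E := T.finrank_range_le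
  have hT := T.isSymmetric_adjoint_comp_self
  set b := hT.eigenvectorBasis rfl with hb
  have hbT (i j) : inner ℝ (T (b i)) (T (b j)) = if i = j then T.singularValues i ^ 2 else 0 := by
    rw [← LinearMap.adjoint_inner_right, ← LinearMap.comp_apply, hb, hT.apply_eigenvectorBasis,
      ← T.sq_singularValues_fin rfl, inner_smul_right,
      orthonormal_iff_ite.1 (hT.eigenvectorBasis rfl).orthonormal]
    aesop
  have hpos (i : Fin (finrank ℝ T.range)) : 0 < T.singularValues i :=
    T.singularValues_pos_iff_lt_finrank_range.2 i.2
  -- Right singular vectors are eigenvectors of T*T; left ones are their images under T, divided by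
  -- the nonzero singular values.
  have hu : Orthonormal ℝ fun i : Fin (finrank ℝ T.range) =>
      (T.singularValues i)⁻¹ • T (b (Fin.castLE hr i)) := by
    rw [orthonormal_iff_ite]
    intro i j
    have := (hpos i).ne'
    rw [inner_smul_left, inner_smul_right, hbT]
    by_cases h : i = j
    · subst h; simp; field_simp
    · simp [h]
  have hv : Orthonormal ℝ fun i : Fin (finrank ℝ T.range) => b (Fin.castLE hr i) :=
    b.orthonormal.comp _ (Fin.castLE_injective hr)
  refine ⟨_, _, hu, hv, b.toBasis.ext fun j => ?_⟩
  rw [b.coe_toBasis]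
  by_cases hj : (j : ℕ) < finrank ℝ T.range
  · have := diagMap_apply_right (fun i : Fin (finrank ℝ T.range) => T.singularValues i)
      (fun i => (T.singularValues i)⁻¹ • T (b (Fin.castLE hr i))) hv ⟨j, hj⟩
    refine Eq.trans ?_ this.symm
    rw [smul_smul, mul_inv_cancel₀ (hpos ⟨j, hj⟩).ne', one_smul]
    rfl
  · have h0 : T (b j) = 0 := by
      rw [← inner_self_eq_zero (𝕜 := ℝ), hbT, if_pos rfl,
        T.singularValues_eq_zero_iff_le_finrank_range.2 (not_lt.1 hj)]
      simp
    rw [h0, diagMap_apply]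
    refine (Finset.sum_eq_zero fun i _ => ?_).symm
    have : Fin.castLE hr i ≠ j := fun h => hj (h ▸ i.2)
    simp [orthonormal_iff_ite.1 b.orthonormal, this]

theorem abs_sum_inner_apply_le (T : E →ₗ[ℝ] F) {a : κ → F} {b : κ → E}
    (ha : Orthonormal ℝ a) (hb : Orthonormal ℝ b) :
    |∑ k, inner ℝ (a k) (T (b k))| ≤ ∑ i : Fin (finrank ℝ T.range), T.singularValues i := by
  obtain ⟨u, v, hu, hv, h⟩ := exists_eq_diagMap_singularValues T
  have hT (x) := LinearMap.congr_fun h x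
  have hs (i : Fin (finrank ℝ T.range)) : 0 ≤ T.singularValues i := T.singularValues_nonneg i
  have := abs_sum_inner_diagMap_le hs hu hv ha hb
  simpa only [← hT] using this

theorem exists_orthonormal_sum_inner_apply_eq (T : E →ₗ[ℝ] F) :
    ∃ (u : Fin (finrank ℝ T.range) → F) (v : Fin (finrank ℝ T.range) → E),
      Orthonormal ℝ u ∧ Orthonormal ℝ v ∧
      ∑ i, inner ℝ (u i) (T (v i)) = ∑ i : Fin (finrank ℝ T.range), T.singularValues i := by
  obtain ⟨u, v, hu, hv, h⟩ := exists_eq_diagMap_singularValues T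
  refine ⟨u, v, hu, hv, ?_⟩
  have hT (x) := LinearMap.congr_fun h x
  simp only [hT]
  exact sum_inner_diagMap_self _ hu hv

theorem sum_singularValues_diagMap_le {s : ι → ℝ} (hs : ∀ i, 0 ≤ s i) {u : ι → F} {v : ι → E}
    (hu : Orthonormal ℝ u) (hv : Orthonormal ℝ v) :
    ∑ i : Fin (finrank ℝ (diagMap s u v).range), (diagMap s u v).singularValues i ≤ ∑ i, s i := by
  obtain ⟨a, b, ha, hb, h⟩ := exists_orthonormal_sum_inner_apply_eq (diagMap s u v)
  rw [← h]
  exact (le_abs_self _).trans (abs_sum_inner_diagMap_le hs hu hv ha hb)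

/-- The families optimal for S + T are admissible, though perhaps not optimal, for S and for T. -/
theorem sum_singularValues_add_le (S T : E →ₗ[ℝ] F) :
    ∑ i : Fin (finrank ℝ (S + T).range), (S + T).singularValues i ≤
      (∑ i : Fin (finrank ℝ S.range), S.singularValues i) +
        ∑ i : Fin (finrank ℝ T.range), T.singularValues i := by
  obtain ⟨a, b, ha, hb, h⟩ := exists_orthonormal_sum_inner_apply_eq (S + T)
  rw [← h]
  simp_rw [LinearMap.add_apply, inner_add_right, Finset.sum_add_distrib]
  exact add_le_add ((le_abs_self _).trans (abs_sum_inner_apply_le S ha hb))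
    ((le_abs_self _).trans (abs_sum_inner_apply_le T ha hb))

theorem sum_singularValues_smul_le (c : ℝ) (T : E →ₗ[ℝ] F) :
    ∑ i : Fin (finrank ℝ (c • T).range), (c • T).singularValues i ≤
      |c| * ∑ i : Fin (finrank ℝ T.range), T.singularValues i := by
  obtain ⟨a, b, ha, hb, h⟩ := exists_orthonormal_sum_inner_apply_eq (c • T)
  rw [← h]
  simp_rw [LinearMap.smul_apply, inner_smul_right, ← Finset.mul_sum]
  refine (le_abs_self _).trans ?_
  rw [abs_mul]
  exact mul_le_mul_of_nonneg_left (abs_sum_inner_apply_le T ha hb) (abs_nonneg c)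

/-! ### Hölder's inequality and its equality case -/

/-- Hölder's inequality `‖A Bᵀ‖_{1/2} ≤ ‖A‖₁ ‖B‖₁` for Schatten quasi-norms. -/
theorem sq_sum_sqrt_singularValues_comp_adjoint_le (A : G →ₗ[ℝ] F) (B : G →ₗ[ℝ] E)
    (X : E →ₗ[ℝ] F) (hX : X = A ∘ₗ LinearMap.adjoint B) :
    (∑ i : Fin (finrank ℝ X.range), √(X.singularValues i)) ^ 2 ≤
      (∑ i : Fin (finrank ℝ A.range), A.singularValues i) *
        ∑ i : Fin (finrank ℝ B.range), B.singularValues i := by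
  obtain ⟨u, v, hu, hv, hXd⟩ := exists_eq_diagMap_singularValues X
  obtain ⟨p, q, hp, hq, hBd⟩ := exists_eq_diagMap_singularValues B
  set σ : Fin (finrank ℝ X.range) → ℝ := fun i => X.singularValues i with hσ
  set τ : Fin (finrank ℝ B.range) → ℝ := fun i => B.singularValues i with hτ
  have hBx (x) : B x = diagMap τ p q x := LinearMap.congr_fun hBd x
  have hσ0 (i) : 0 < σ i := X.singularValues_pos_iff_lt_finrank_range.2 i.2
  have hτ0 (k) : 0 < τ k := B.singularValues_pos_iff_lt_finrank_range.2 k.2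
  have hB' : LinearMap.adjoint B = diagMap τ q p := by
    conv_lhs => rw [hBd]
    exact adjoint_diagMap _ _ _
  have hX' : LinearMap.adjoint X = diagMap σ v u := by
    conv_lhs => rw [hXd]
    exact adjoint_diagMap _ _ _
  have hvp (i) : v i ∈ Submodule.span ℝ (Set.range p) := by
    have h1 : LinearMap.adjoint X (u i) = σ i • v i := by
      rw [hX', diagMap_apply_right _ _ hu]
    have h2 : LinearMap.adjoint X (u i) = B (LinearMap.adjoint A (u i)) := by
      rw [hX, LinearMap.adjoint_comp, LinearMap.adjoint_adjoint, LinearMap.comp_apply]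
    have h3 : v i = (σ i)⁻¹ • B (LinearMap.adjoint A (u i)) := by
      rw [← h2, h1, smul_smul, inv_mul_cancel₀ (hσ0 i).ne', one_smul]
    rw [h3, hBx, diagMap_apply]
    exact Submodule.smul_mem _ _ (Submodule.sum_mem _ fun k _ =>
      Submodule.smul_mem _ _ (Submodule.subset_span ⟨k, rfl⟩))
  set c : Fin (finrank ℝ X.range) → Fin (finrank ℝ B.range) → ℝ := fun i k => inner ℝ (p k) (v i)
    with hc
  have hcc (i) : ∑ k, c i k ^ 2 = 1 := by
    have := hp.sum_inner_mul_inner_of_mem_span (hvp i) (v i)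
    rw [real_inner_self_eq_norm_sq, hv.1 i, one_pow] at this
    simpa [hc, sq] using this
  -- The isometry `p k ↦ q k` from the polar decomposition of B carries `v i` to `y i`; since `v i`
  -- lies in the range of B, orthonormality survives.
  set y : Fin (finrank ℝ X.range) → G := fun i => ∑ k, c i k • q k with hy
  have hyo : Orthonormal ℝ y := by
    rw [orthonormal_iff_ite]
    intro i j
    rw [← orthonormal_iff_ite.1 hv i j, hy, hq.inner_sum,
      ← hp.sum_inner_mul_inner_of_mem_span (hvp i) (v j)]
    simp [hc]
  have hAq (k) : A (q k) = (τ k)⁻¹ • X (p k) := by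
    rw [hX, LinearMap.comp_apply, hB', diagMap_apply_right _ _ hp, map_smul, smul_smul,
      inv_mul_cancel₀ (hτ0 k).ne', one_smul]
  have huX (i) (x : E) : inner ℝ (u i) (X x) = σ i * inner ℝ x (v i) := by
    rw [← LinearMap.adjoint_inner_left, hX', diagMap_apply_right _ _ hu, inner_smul_left,
      real_inner_comm]
    rfl
  have hAy (i) : inner ℝ (u i) (A (y i)) = σ i * ∑ k, c i k ^ 2 / τ k := by
    rw [hy, map_sum, inner_sum, Finset.mul_sum]
    refine Finset.sum_congr rfl fun k _ => ?_
    rw [map_smul, inner_smul_right, hAq, inner_smul_right, huX]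
    simp only [hc]
    ring
  have hBy (i) : inner ℝ (v i) (B (y i)) = ∑ k, τ k * c i k ^ 2 := by
    rw [hBx, inner_diagMap_apply]
    refine Finset.sum_congr rfl fun k _ => ?_
    rw [hy, hq.inner_right_fintype]
    ring
  -- Cauchy–Schwarz: (∑ c²/τ)(∑ τc²) ≥ (∑ c²)² = 1.
  have hle (i) : σ i ≤ inner ℝ (u i) (A (y i)) * inner ℝ (v i) (B (y i)) := by
    rw [hAy, hBy, mul_assoc]
    refine le_mul_of_one_le_right (hσ0 i).le ?_
    have := Finset.sum_sq_le_sum_mul_sum_of_sq_le_mul Finset.univ (r := fun k => c i k ^ 2)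
      (f := fun k => c i k ^ 2 / τ k) (g := fun k => τ k * c i k ^ 2)
      (fun k _ => div_nonneg (sq_nonneg _) (hτ0 k).le)
      (fun k _ => mul_nonneg (hτ0 k).le (sq_nonneg _))
      (fun k _ => le_of_eq (by have := (hτ0 k).ne'; field_simp))
    rwa [hcc, one_pow] at this
  have hA0 (i) : 0 ≤ inner ℝ (u i) (A (y i)) := by
    rw [hAy]
    exact mul_nonneg (hσ0 i).le (Finset.sum_nonneg fun k _ => div_nonneg (sq_nonneg _) (hτ0 k).le)
  have hB0 (i) : 0 ≤ inner ℝ (v i) (B (y i)) := by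
    rw [hBy]
    exact Finset.sum_nonneg fun k _ => mul_nonneg (hτ0 k).le (sq_nonneg _)
  calc (∑ i, √(σ i)) ^ 2
      ≤ (∑ i, √(inner ℝ (u i) (A (y i)) * inner ℝ (v i) (B (y i)))) ^ 2 := by
        gcongr with i
        exact hle i
    -- Cauchy–Schwarz over `i`; von Neumann's bound then controls each factor.
    _ ≤ (∑ i, inner ℝ (u i) (A (y i))) * ∑ i, inner ℝ (v i) (B (y i)) :=
        Finset.sum_sq_le_sum_mul_sum_of_sq_le_mul _ (fun i _ => hA0 i) (fun i _ => hB0 i)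
          fun i _ => (Real.sq_sqrt (mul_nonneg (hA0 i) (hB0 i))).le
    _ ≤ _ := mul_le_mul ((le_abs_self _).trans (abs_sum_inner_apply_le A hu hyo))
        ((le_abs_self _).trans (abs_sum_inner_apply_le B hv hyo))
        (Finset.sum_nonneg fun i _ => hB0 i)
        (Finset.sum_nonneg fun i _ => A.singularValues_nonneg i)

/-- The balanced factorization of a map of rank at most `finrank G`. -/
theorem exists_comp_adjoint_eq_sum_singularValues_le (X : E →ₗ[ℝ] F)
    (hX : finrank ℝ X.range ≤ finrank ℝ G) :
    ∃ (A : G →ₗ[ℝ] F) (B : G →ₗ[ℝ] E), X = A ∘ₗ LinearMap.adjoint B ∧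
      ∑ i : Fin (finrank ℝ A.range), A.singularValues i ≤
        ∑ i : Fin (finrank ℝ X.range), √(X.singularValues i) ∧
      ∑ i : Fin (finrank ℝ B.range), B.singularValues i ≤
        ∑ i : Fin (finrank ℝ X.range), √(X.singularValues i) := by
  obtain ⟨u, v, hu, hv, hXd⟩ := exists_eq_diagMap_singularValues X
  -- The rank bound is what leaves room in G for one orthonormal vector per nonzero singular value.
  set e := fun i => stdOrthonormalBasis ℝ G (Fin.castLE hX i)
  have he : Orthonormal ℝ e :=
    (stdOrthonormalBasis ℝ G).orthonormal.comp _ (Fin.castLE_injective hX)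
  set ρ : Fin (finrank ℝ X.range) → ℝ := fun i => √(X.singularValues i)
  have hρ (i) : 0 ≤ ρ i := Real.sqrt_nonneg _
  refine ⟨diagMap ρ u e, diagMap ρ v e, ?_, sum_singularValues_diagMap_le hρ hu he,
    sum_singularValues_diagMap_le hρ hv he⟩
  rw [adjoint_diagMap]
  ext x
  rw [LinearMap.comp_apply, diagMap_apply _ e v, map_sum, LinearMap.congr_fun hXd x,
    diagMap_apply]
  refine Finset.sum_congr rfl fun i _ => ?_
  rw [map_smul, diagMap_apply_right _ _ he, smul_smul, mul_right_comm,
    Real.mul_self_sqrt (X.singularValues_nonneg i)]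

end SingularValueDecomposition


/-! ### Transfer to matrices, and the quasi-norm axioms -/

section Matrix

open Module

variable {m n : ℕ}

theorem Matrix.finrank_range_toEuclideanLin (X : Matrix (Fin m) (Fin n) ℝ) :
    finrank ℝ (Matrix.toEuclideanLin X).range = X.rank :=
  (X.rank_eq_finrank_range_toLin (PiLp.basisFun _ _ _) (PiLp.basisFun _ _ _)).symm

theorem Matrix.rank_le_min (X : Matrix (Fin m) (Fin n) ℝ) : X.rank ≤ min m n :=
  le_min X.rank_le_height X.rank_le_width

theorem Matrix.rank_smul_le (a : ℝ) (X : Matrix (Fin m) (Fin n) ℝ) : (a • X).rank ≤ X.rank := by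
  simpa using Matrix.rank_mul_le_right (a • (1 : Matrix (Fin m) (Fin m) ℝ)) X

theorem matrixSingularValue_nonneg (X : Matrix (Fin m) (Fin n) ℝ) (i : ℕ) :
    0 ≤ matrixSingularValue X i :=
  LinearMap.singularValues_nonneg _ _

/-- Singular values past the rank vanish, so `f 0 = 0` makes the two index ranges interchangeable.
-/
theorem sum_range_matrixSingularValue (X : Matrix (Fin m) (Fin n) ℝ) {f : ℝ → ℝ} (hf : f 0 = 0) :
    ∑ i ∈ Finset.range (min m n), f (matrixSingularValue X i) =
      ∑ i : Fin (finrank ℝ (Matrix.toEuclideanLin X).range),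
        f ((Matrix.toEuclideanLin X).singularValues i) := by
  rw [Fin.sum_univ_eq_sum_range (fun i => f ((Matrix.toEuclideanLin X).singularValues i))]
  symm
  refine Finset.sum_subset ?_ fun i _ hi => ?_
  · rw [Finset.range_subset_range, X.finrank_range_toEuclideanLin]
    exact X.rank_le_min
  · rw [(LinearMap.singularValues_eq_zero_iff_le_finrank_range _).2 (by simpa using hi), hf]

theorem traceNorm_eq_sum (X : Matrix (Fin m) (Fin n) ℝ) :
    traceNorm X = ∑ i : Fin (finrank ℝ (Matrix.toEuclideanLin X).range),
      (Matrix.toEuclideanLin X).singularValues i :=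
  sum_range_matrixSingularValue X (f := id) rfl

theorem schattenNorm_half (X : Matrix (Fin m) (Fin n) ℝ) :
    schattenNorm (1 / 2) X =
      (∑ i ∈ Finset.range (min m n), √(matrixSingularValue X i)) ^ 2 := by
  simp only [schattenNorm, ← Real.sqrt_eq_rpow]
  norm_num

theorem schattenNorm_half_eq_sum (X : Matrix (Fin m) (Fin n) ℝ) :
    schattenNorm (1 / 2) X = (∑ i : Fin (finrank ℝ (Matrix.toEuclideanLin X).range),
      √((Matrix.toEuclideanLin X).singularValues i)) ^ 2 := by
  rw [schattenNorm_half, sum_range_matrixSingularValue X Real.sqrt_zero]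

theorem traceNorm_nonneg (X : Matrix (Fin m) (Fin n) ℝ) : 0 ≤ traceNorm X :=
  Finset.sum_nonneg fun i _ => matrixSingularValue_nonneg X i

theorem traceNorm_add_le (X Y : Matrix (Fin m) (Fin n) ℝ) :
    traceNorm (X + Y) ≤ traceNorm X + traceNorm Y := by
  simp_rw [traceNorm_eq_sum]
  rw [map_add]
  exact sum_singularValues_add_le _ _

theorem traceNorm_smul_le (a : ℝ) (X : Matrix (Fin m) (Fin n) ℝ) :
    traceNorm (a • X) ≤ |a| * traceNorm X := by
  simp_rw [traceNorm_eq_sum]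
  rw [map_smul]
  exact sum_singularValues_smul_le _ _

theorem traceNorm_eq_zero_iff {X : Matrix (Fin m) (Fin n) ℝ} : traceNorm X = 0 ↔ X = 0 := by
  constructor
  · intro h
    rw [traceNorm_eq_sum, Finset.sum_eq_zero_iff_of_nonneg
      fun i _ => LinearMap.singularValues_nonneg _ _] at h
    obtain ⟨u, v, -, -, hX⟩ := exists_eq_diagMap_singularValues (Matrix.toEuclideanLin X)
    rw [← (Matrix.toEuclideanLin (𝕜 := ℝ) (m := Fin m) (n := Fin n)).map_eq_zero_iff, hX]
    ext1 x
    rw [diagMap_apply, LinearMap.zero_apply]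
    exact Finset.sum_eq_zero fun i hi => by simp [h i hi]
  · rintro rfl
    simp [traceNorm, matrixSingularValue]

theorem traceNorm_le_schattenNorm_half (X : Matrix (Fin m) (Fin n) ℝ) :
    traceNorm X ≤ schattenNorm (1 / 2) X := by
  rw [schattenNorm_half, traceNorm]
  refine le_trans (Finset.sum_le_sum fun i _ => ?_)
    (Finset.sum_sq_le_sq_sum_of_nonneg fun i _ => Real.sqrt_nonneg (matrixSingularValue X i))
  rw [Real.sq_sqrt (matrixSingularValue_nonneg X i)]

theorem schattenNorm_half_le_mul_traceNorm (X : Matrix (Fin m) (Fin n) ℝ) :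
    schattenNorm (1 / 2) X ≤ (min m n : ℕ) * traceNorm X := by
  rw [schattenNorm_half, traceNorm]
  refine (sq_sum_le_card_mul_sum_sq (s := Finset.range (min m n))).trans_eq ?_
  rw [Finset.card_range]
  congr 1
  exact Finset.sum_congr rfl fun i _ => Real.sq_sqrt (matrixSingularValue_nonneg X i)

theorem toEuclideanLin_mul_transpose {d : ℕ} (U : Matrix (Fin m) (Fin d) ℝ)
    (V : Matrix (Fin n) (Fin d) ℝ) :
    Matrix.toEuclideanLin (U * V.transpose) =
      Matrix.toEuclideanLin U ∘ₗ LinearMap.adjoint (Matrix.toEuclideanLin V) := by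
  rw [← Matrix.toEuclideanLin_conjTranspose_eq_adjoint, Matrix.conjTranspose_eq_transpose_of_trivial]
  exact Matrix.toLpLin_mul_same _ _ _

theorem schattenNorm_half_mul_transpose_le {d : ℕ} (U : Matrix (Fin m) (Fin d) ℝ)
    (V : Matrix (Fin n) (Fin d) ℝ) :
    schattenNorm (1 / 2) (U * V.transpose) ≤ traceNorm U * traceNorm V := by
  rw [schattenNorm_half_eq_sum, traceNorm_eq_sum, traceNorm_eq_sum]
  exact sq_sum_sqrt_singularValues_comp_adjoint_le _ _ _ (toEuclideanLin_mul_transpose U V)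

/-- A factorization that minimizes the trace norms of both factors. -/
theorem exists_mul_transpose_eq_traceNorm_eq {d : ℕ} (X : Matrix (Fin m) (Fin n) ℝ)
    (hX : X.rank ≤ d) :
    ∃ (U : Matrix (Fin m) (Fin d) ℝ) (V : Matrix (Fin n) (Fin d) ℝ), X = U * V.transpose ∧
      traceNorm U = √(schattenNorm (1 / 2) X) ∧ traceNorm V = √(schattenNorm (1 / 2) X) := by
  obtain ⟨A, B, hAB, hA, hB⟩ := exists_comp_adjoint_eq_sum_singularValues_le
    (G := EuclideanSpace ℝ (Fin d)) (Matrix.toEuclideanLin X)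
    (by rwa [X.finrank_range_toEuclideanLin, finrank_euclideanSpace_fin])
  obtain ⟨U, rfl⟩ := Matrix.toEuclideanLin.surjective A
  obtain ⟨V, rfl⟩ := Matrix.toEuclideanLin.surjective B
  rw [← toEuclideanLin_mul_transpose] at hAB
  have hXUV := Matrix.toEuclideanLin.injective hAB
  have hle := schattenNorm_half_mul_transpose_le U V
  rw [← hXUV, schattenNorm_half_eq_sum] at hle
  rw [← traceNorm_eq_sum] at hA hB
  have hS : 0 ≤ ∑ i : Fin (finrank ℝ (Matrix.toEuclideanLin X).range),
      √((Matrix.toEuclideanLin X).singularValues i) :=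
    Finset.sum_nonneg fun i _ => Real.sqrt_nonneg _
  refine ⟨U, V, hXUV, ?_⟩
  rw [schattenNorm_half_eq_sum, Real.sqrt_sq hS]
  have hU := traceNorm_nonneg U
  have hV := traceNorm_nonneg V
  set S := ∑ i : Fin (finrank ℝ (Matrix.toEuclideanLin X).range),
      √((Matrix.toEuclideanLin X).singularValues i)
  -- Both trace norms are at most S and their product is at least S², so both equal S; cancelling
  -- needs S ≠ 0.
  rcases hS.eq_or_lt with h0 | h0
  · constructor <;> linarith
  · constructor
    · refine hA.antisymm (le_of_mul_le_mul_right ?_ h0)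
      nlinarith
    · refine hB.antisymm (le_of_mul_le_mul_left ?_ h0)
      nlinarith

theorem schattenNorm_half_nonneg (X : Matrix (Fin m) (Fin n) ℝ) : 0 ≤ schattenNorm (1 / 2) X :=
  (traceNorm_nonneg X).trans (traceNorm_le_schattenNorm_half X)

/-- Any function of the two trace norms that dominates their product and agrees with it on the
diagonal has minimum `‖X‖_{1/2}` over the factorizations of `X`. -/
theorem isLeast_schattenNorm_half {d : ℕ} {X : Matrix (Fin m) (Fin n) ℝ} (hX : X.rank ≤ d)
    {f : ℝ → ℝ → ℝ} (hf : ∀ x y, x * y ≤ f x y) (hdiag : ∀ x, f x x = x ^ 2) :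
    IsLeast {t : ℝ | ∃ (U : Matrix (Fin m) (Fin d) ℝ) (V : Matrix (Fin n) (Fin d) ℝ),
      X = U * V.transpose ∧ t = f (traceNorm U) (traceNorm V)} (schattenNorm (1 / 2) X) := by
  constructor
  · obtain ⟨U, V, h, hU, hV⟩ := exists_mul_transpose_eq_traceNorm_eq X hX
    refine ⟨U, V, h, ?_⟩
    rw [hU, hV, hdiag, Real.sq_sqrt (schattenNorm_half_nonneg X)]
  · rintro t ⟨U, V, rfl, rfl⟩
    exact (schattenNorm_half_mul_transpose_le U V).trans (hf _ _)

theorem biTraceNorm_eq_schattenNorm_half {d : ℕ} {X : Matrix (Fin m) (Fin n) ℝ}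
    (hX : X.rank ≤ d) : biTraceNorm d X = schattenNorm (1 / 2) X :=
  (isLeast_schattenNorm_half hX (fun _ _ => le_rfl) fun x => (sq x).symm).csInf_eq

/-- Scaling one factor of an optimal factorization avoids computing the singular values of `a • X`.
-/
theorem schattenNorm_half_smul_le (a : ℝ) (X : Matrix (Fin m) (Fin n) ℝ) :
    schattenNorm (1 / 2) (a • X) ≤ |a| * schattenNorm (1 / 2) X := by
  obtain ⟨U, V, h, hU, hV⟩ := exists_mul_transpose_eq_traceNorm_eq X le_rfl
  calc schattenNorm (1 / 2) (a • X) = schattenNorm (1 / 2) ((a • U) * V.transpose) := by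
        rw [Matrix.smul_mul, ← h]
    _ ≤ traceNorm (a • U) * traceNorm V := schattenNorm_half_mul_transpose_le _ _
    _ ≤ |a| * traceNorm U * traceNorm V :=
        mul_le_mul_of_nonneg_right (traceNorm_smul_le a U) (traceNorm_nonneg V)
    _ = |a| * schattenNorm (1 / 2) X := by
        rw [hU, hV, mul_assoc, Real.mul_self_sqrt (schattenNorm_half_nonneg X)]

theorem schattenNorm_half_smul (a : ℝ) (X : Matrix (Fin m) (Fin n) ℝ) :
    schattenNorm (1 / 2) (a • X) = |a| * schattenNorm (1 / 2) X := by
  refine (schattenNorm_half_smul_le a X).antisymm ?_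
  rcases eq_or_ne a 0 with rfl | ha
  · simpa using schattenNorm_half_nonneg (0 : Matrix (Fin m) (Fin n) ℝ)
  · have := schattenNorm_half_smul_le a⁻¹ (a • X)
    rwa [smul_smul, inv_mul_cancel₀ ha, one_smul, abs_inv, ← div_eq_inv_mul,
      le_div_iff₀' (abs_pos.2 ha)] at this

theorem schattenNorm_half_eq_zero_iff {X : Matrix (Fin m) (Fin n) ℝ} :
    schattenNorm (1 / 2) X = 0 ↔ X = 0 := by
  rw [← traceNorm_eq_zero_iff]
  constructor <;> intro h
  · exact ((traceNorm_le_schattenNorm_half X).trans_eq h).antisymm (traceNorm_nonneg X)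
  · refine le_antisymm ?_ (schattenNorm_half_nonneg X)
    simpa [h] using schattenNorm_half_le_mul_traceNorm X

/-- Passing through the trace norm costs a factor min(m, n), from Cauchy–Schwarz on that many terms;
the maximum with 1 keeps α ≥ 1 for empty matrices. -/
theorem schattenNorm_half_add_le (X Y : Matrix (Fin m) (Fin n) ℝ) :
    schattenNorm (1 / 2) (X + Y) ≤
      max 1 ((min m n : ℕ) : ℝ) * (schattenNorm (1 / 2) X + schattenNorm (1 / 2) Y) :=
  calc _ ≤ ((min m n : ℕ) : ℝ) * traceNorm (X + Y) := schattenNorm_half_le_mul_traceNorm _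
    _ ≤ max 1 ((min m n : ℕ) : ℝ) * (schattenNorm (1 / 2) X + schattenNorm (1 / 2) Y) :=
      mul_le_mul (le_max_right _ _) ((traceNorm_add_le X Y).trans
        (add_le_add (traceNorm_le_schattenNorm_half X) (traceNorm_le_schattenNorm_half Y)))
        (traceNorm_nonneg _) (zero_le_one.trans (le_max_left _ _))

theorem isQuasiNormOn_biTraceNorm (m n d : ℕ) :
    IsQuasiNormOn (max 1 ((min m n : ℕ) : ℝ)) {X : Matrix (Fin m) (Fin n) ℝ | X.rank ≤ d}
      (biTraceNorm d) where
  nonneg X hX := by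
    rw [biTraceNorm_eq_schattenNorm_half hX]
    exact schattenNorm_half_nonneg X
  eq_zero_iff X hX := by
    rw [biTraceNorm_eq_schattenNorm_half hX]
    exact schattenNorm_half_eq_zero_iff
  smul a X hX := by
    have haX : (a • X).rank ≤ d := (Matrix.rank_smul_le a X).trans hX
    refine ⟨haX, ?_⟩
    rw [biTraceNorm_eq_schattenNorm_half hX, biTraceNorm_eq_schattenNorm_half haX]
    exact schattenNorm_half_smul a X
  add_le X hX Y hY hXY := by
    rw [biTraceNorm_eq_schattenNorm_half hX, biTraceNorm_eq_schattenNorm_half hY,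
      biTraceNorm_eq_schattenNorm_half hXY]
    exact schattenNorm_half_add_le X Y

end Matrix

end

theorem theorem1 (m n : ℕ) :
    (∃ α : ℝ, 1 ≤ α ∧
      (∀ d : ℕ, min m n ≤ d →
        IsQuasiNormOn α (Set.univ : Set (Matrix (Fin m) (Fin n) ℝ)) (biTraceNorm d)) ∧
      (∀ d : ℕ,
        IsQuasiNormOn α {X : Matrix (Fin m) (Fin n) ℝ | X.rank ≤ d} (biTraceNorm d))) ∧
    ∀ (d : ℕ) (X : Matrix (Fin m) (Fin n) ℝ), X.rank ≤ d →
      biTraceNorm d X = schattenNorm (1 / 2) X ∧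
      IsLeast {t : ℝ | ∃ (U : Matrix (Fin m) (Fin d) ℝ) (V : Matrix (Fin n) (Fin d) ℝ),
        X = U * V.transpose ∧ t = traceNorm U * traceNorm V} (biTraceNorm d X) ∧
      IsLeast {t : ℝ | ∃ (U : Matrix (Fin m) (Fin d) ℝ) (V : Matrix (Fin n) (Fin d) ℝ),
        X = U * V.transpose ∧ t = (traceNorm U ^ 2 + traceNorm V ^ 2) / 2} (biTraceNorm d X) ∧
      IsLeast {t : ℝ | ∃ (U : Matrix (Fin m) (Fin d) ℝ) (V : Matrix (Fin n) (Fin d) ℝ),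
        X = U * V.transpose ∧ t = ((traceNorm U + traceNorm V) / 2) ^ 2} (biTraceNorm d X) := by
  refine ⟨⟨max 1 ((min m n : ℕ) : ℝ), le_max_left _ _, fun d hd => ?_,
    isQuasiNormOn_biTraceNorm m n⟩, fun d X hX => ?_⟩
  · have huniv : {X : Matrix (Fin m) (Fin n) ℝ | X.rank ≤ d} = Set.univ :=
      Set.eq_univ_of_forall fun X => X.rank_le_min.trans hd
    exact huniv ▸ isQuasiNormOn_biTraceNorm m n d
  · rw [biTraceNorm_eq_schattenNorm_half hX]
    exact ⟨rfl, isLeast_schattenNorm_half hX (fun _ _ => le_rfl) fun x => (sq x).symm,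
      isLeast_schattenNorm_half hX (f := fun x y => (x ^ 2 + y ^ 2) / 2)
        (fun x y => by nlinarith [sq_nonneg (x - y)]) fun x => by ring,
      isLeast_schattenNorm_half hX (f := fun x y => ((x + y) / 2) ^ 2)
        (fun x y => by nlinarith [sq_nonneg (x - y)]) fun x => by ring⟩
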